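/- Let $(\Omega,\mu)$ be a $\sigma$-finite measure space, let $p \in [1,\infty)$, and let $T : L^p \to L^p$ be a linear operator on the complex-valued space $L^p := L^p(\Omega,\mu)$. For $f \in L^p$ write $f \ge 0$ if $f(\omega)$ is a nonnegative real number for almost every $\omega$, and let $\operatorname{supp} f := \{\omega \in \Omega : f(\omega) \ne 0\}$, which is defined up to a null set. Assume that - $T$ is positive, i.e. $Tf \ge 0$ for every $f \in L^p$ with $f \ge 0$; - $T$ is power bounded, i.e. $\sup_{n \in \mathbb{N}_0} \|T^n\| < \infty$; - for every $f \in L^p$ with $f \ge 0$ there exists an integer $n \ge 1$ (possibly depending on $f$) such that $\operatorname{supp}(T^n f) \supseteq \operatorname{supp}(T^{n-1} f)$ up to a null set. Then $\sigma_{\mathrm{pnt}}(T) \cap \mathbb{T} \subseteq \{1\}$, where $\sigma_{\mathrm{pnt}}(T)$ denotes the set of eigenvalues of $T$ and $\mathbb{T} := \{\lambda \in \mathbb{C} : |\lambda| = 1\}$; that is, the only possible eigenvalue of $T$ of modulus $1$ is $1$. -/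

import Mathlib

open MeasureTheory
open scoped ENNReal ComplexOrder

namespace Aperiodicity

variable {Ω : Type*} [MeasurableSpace Ω] {μ : Measure Ω} {p : ℝ≥0∞}

/-- `0 ≤ f` for a complex-valued `f ∈ L^p`: almost everywhere, `f ω` is a nonnegative real
number (this is what `0 ≤ z` means for `z : ℂ`). -/
def Nonneg (f : Lp ℂ p μ) : Prop :=
  ∀ᵐ ω ∂μ, 0 ≤ f ω

/-- A linear operator on the complex space `L^p` is positive if `T f ≥ 0` whenever `f ≥ 0`. -/
def IsPositiveOperator (T : Lp ℂ p μ →ₗ[ℂ] Lp ℂ p μ) : Prop :=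
  ∀ f : Lp ℂ p μ, Nonneg f → Nonneg (T f)

/-- The support of `g` contains the support of `f` up to a null set, where the support of a
function is the set of points at which it does not vanish. -/
def SupportContains (g f : Lp ℂ p μ) : Prop :=
  Function.support (f : Ω → ℂ) ≤ᵐ[μ] Function.support (g : Ω → ℂ)

/-- Power boundedness, `sup_{n ≥ 0} ‖T ^ n‖ < ∞`, with the bound on the operator norms spelled
out; the case `n = 1` says that `T` is bounded. -/
def IsPowerBounded {E : Type*} [NormedAddCommGroup E] [NormedSpace ℂ E] (T : E →ₗ[ℂ] E) : Prop :=
  ∃ C : ℝ, ∀ (n : ℕ) (f : E), ‖(T ^ n) f‖ ≤ C * ‖f‖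

/-- The point spectrum: the set of all eigenvalues. -/
def pointSpectrum {E : Type*} [NormedAddCommGroup E] [NormedSpace ℂ E] (T : E →ₗ[ℂ] E) : Set ℂ :=
  {z | Module.End.HasEigenvalue T z}

end Aperiodicity

namespace Aperiodicity

open Filter Topology

variable {Ω : Type*} [MeasurableSpace Ω] {μ : Measure Ω} {p : ℝ≥0∞}

/-! Let `T f = z • f` with `‖z‖ = 1`, `z ≠ 1`, and put `F = |f|`. Then `F ≤ T F`, so the powers `T ^
n F` increase; they are norm bounded and `p < ∞`, so they converge, and each `T ^ n F - F` has an
orbit tending to zero (`orbitVanishes_pow_sub`). Thus `F` is invariant up to a negligible part.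
Where `T ^ n F = F`, there is no cancellation, so `T ^ n` carries the part `g` of `F` with phase of
`f` near `a` to points where `z ^ n * f` has phase near `a` (`phase_transport`). If `T ^ (k + 1) g`
is nonzero wherever `T ^ k g` is, then both `z ^ k * f` and `z ^ (k + 1) * f` have phase near `a`
there, impossible as `z ≠ 1`. So `T ^ k g` lives on the negligible part and its orbit vanishes
(`OrbitVanishes.of_support`). Finitely many such `g` dominate `F`, so `T ^ m F` tends to zero; but
it increases from `F`, hence `F = 0`. -/

/-! ### Positive operators on complex `L^p` -/

theorem nonneg_iff {f : Lp ℂ p μ} : Nonneg f ↔ 0 ≤ f := Lp.coeFn_nonneg f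

theorem IsPositiveOperator.pow {T : Lp ℂ p μ →ₗ[ℂ] Lp ℂ p μ} (hT : IsPositiveOperator T) (n : ℕ) :
    IsPositiveOperator (T ^ n) := by
  induction n with
  | zero => exact fun f hf => hf
  | succ n ih =>
    intro f hf
    rw [pow_succ']
    exact hT _ (ih f hf)

theorem IsPositiveOperator.map_nonneg {T : Lp ℂ p μ →ₗ[ℂ] Lp ℂ p μ} (hT : IsPositiveOperator T)
    {f : Lp ℂ p μ} (hf : 0 ≤ f) : 0 ≤ T f :=
  nonneg_iff.1 (hT f (nonneg_iff.2 hf))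

theorem IsPositiveOperator.mono {T : Lp ℂ p μ →ₗ[ℂ] Lp ℂ p μ} (hT : IsPositiveOperator T)
    {f g : Lp ℂ p μ} (h : f ≤ g) : T f ≤ T g := by
  have := hT.map_nonneg (sub_nonneg.2 h)
  rwa [map_sub, sub_nonneg] at this

/-- A positive operator preserves nonnegativity of the real part. -/
theorem IsPositiveOperator.re_nonneg {T : Lp ℂ p μ →ₗ[ℂ] Lp ℂ p μ} (hT : IsPositiveOperator T)
    {f : Lp ℂ p μ} (hf : ∀ᵐ x ∂μ, 0 ≤ (f x).re) : ∀ᵐ x ∂μ, 0 ≤ (T f x).re := by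
  have hre : MemLp (fun x => (((f x).re : ℝ) : ℂ)) p μ := (Lp.memLp f).re.ofReal
  have him : MemLp (fun x => (((f x).im ⊔ 0 : ℝ) : ℂ)) p μ :=
    ((Lp.memLp f).im.sup (MemLp.zero' (ε := ℝ))).ofReal
  have him' : MemLp (fun x => ((-(f x).im ⊔ 0 : ℝ) : ℂ)) p μ :=
    ((Lp.memLp f).im.neg.sup (MemLp.zero' (ε := ℝ))).ofReal
  -- The real part is nonnegative by assumption; the imaginary part is a difference of nonnegative
  -- functions, so its image is real and adds nothing to the real part.
  have hdec : f = hre.toLp _ + Complex.I • (him.toLp _ - him'.toLp _) := by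
    apply Lp.ext
    filter_upwards [hre.coeFn_toLp, him.coeFn_toLp, him'.coeFn_toLp,
      Lp.coeFn_add (hre.toLp _) (Complex.I • (him.toLp _ - him'.toLp _)),
      Lp.coeFn_smul Complex.I (him.toLp _ - him'.toLp _),
      Lp.coeFn_sub (him.toLp _) (him'.toLp _)] with x h1 h2 h3 h4 h5 h6
    rw [h4, Pi.add_apply, h5, Pi.smul_apply, h6, Pi.sub_apply, h1, h2, h3]
    apply Complex.ext
    · simp
    · have : (f x).im ⊔ 0 - (-(f x).im) ⊔ 0 = (f x).im := by
        rcases le_total 0 (f x).im with h | h <;> simp [h]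
      simp [this]
  have p1 : Nonneg (hre.toLp _) := by
    filter_upwards [hre.coeFn_toLp, hf] with x h1 h2
    rw [h1]; exact_mod_cast h2
  have p2 : Nonneg (him.toLp _) := by
    filter_upwards [him.coeFn_toLp] with x h1
    rw [h1]; exact_mod_cast le_sup_right
  have p3 : Nonneg (him'.toLp _) := by
    filter_upwards [him'.coeFn_toLp] with x h1
    rw [h1]; exact_mod_cast le_sup_right
  rw [hdec, map_add, map_smul, map_sub]
  filter_upwards [hT _ p1, hT _ p2, hT _ p3,
      Lp.coeFn_add (T (hre.toLp _)) (Complex.I • (T (him.toLp _) - T (him'.toLp _))),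
      Lp.coeFn_smul Complex.I (T (him.toLp _) - T (him'.toLp _)),
      Lp.coeFn_sub (T (him.toLp _)) (T (him'.toLp _))] with x h1 h2 h3 h4 h5 h6
  rw [h4, Pi.add_apply, h5, Pi.smul_apply, h6, Pi.sub_apply]
  rw [Complex.le_def] at h1 h2 h3
  simp only [Complex.zero_re, Complex.zero_im] at h1 h2 h3
  simp [← h2.2, ← h3.2, h1.1]

/-- If `g` is a nonnegative function with `‖c‖ F - Re (conj c * f) ≥ (‖c‖ t - Re (conj c * a)) g`
for all `c : ℂ`, then the images under a positive operator satisfy the same inequalities, and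
these hold simultaneously for all `c` outside a common null set. -/
theorem IsPositiveOperator.ae_forall_le (hT : IsPositiveOperator T) {f F g : Lp ℂ p μ} (a : ℂ)
    (t : ℝ) (h : ∀ c : ℂ, ∀ᵐ x ∂μ, (‖c‖ * t - (star c * a).re) * (g x).re ≤
      ‖c‖ * (F x).re - (star c * f x).re) :
    ∀ᵐ x ∂μ, ∀ c : ℂ, (‖c‖ * t - (star c * a).re) * (T g x).re ≤
      ‖c‖ * (T F x).re - (star c * T f x).re := by
  have hc (c : ℂ) : ∀ᵐ x ∂μ, (‖c‖ * t - (star c * a).re) * (T g x).re ≤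
      ‖c‖ * (T F x).re - (star c * T f x).re := by
    have e (f F g : Lp ℂ p μ) : ∀ᵐ x ∂μ,
        (((‖c‖ : ℂ) • F - star c • f - ((‖c‖ * t - (star c * a).re : ℝ) : ℂ) • g :
          Lp ℂ p μ) x).re =
        ‖c‖ * (F x).re - (star c * f x).re - (‖c‖ * t - (star c * a).re) * (g x).re := by
      filter_upwards [
        Lp.coeFn_sub ((‖c‖ : ℂ) • F - star c • f) (((‖c‖ * t - (star c * a).re : ℝ) : ℂ) • g),
        Lp.coeFn_sub ((‖c‖ : ℂ) • F) (star c • f), Lp.coeFn_smul (‖c‖ : ℂ) F,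
        Lp.coeFn_smul (star c) f,
        Lp.coeFn_smul ((‖c‖ * t - (star c * a).re : ℝ) : ℂ) g] with x h1 h2 h3 h4 h5
      rw [h1, Pi.sub_apply, h2, Pi.sub_apply, h3, h4, h5]
      simp only [Pi.smul_apply, smul_eq_mul, Complex.sub_re, Complex.re_ofReal_mul]
    have := hT.re_nonneg (f := (‖c‖ : ℂ) • F - star c • f -
      ((‖c‖ * t - (star c * a).re : ℝ) : ℂ) • g) (by
        filter_upwards [e f F g, h c] with x h1 h2
        rw [h1]; linarith)
    simp only [map_sub, map_smul] at this
    filter_upwards [this, e (T f) (T F) (T g)] with x h1 h2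
    rw [h2] at h1; linarith
  -- Both sides are continuous in `c`, so a countable dense set suffices. The common null set later
  -- allows `c` to depend on `x`.
  filter_upwards [ae_all_iff.2 fun n => hc (TopologicalSpace.denseSeq ℂ n)] with x hx c
  have hcl : IsClosed {c : ℂ | (‖c‖ * t - (star c * a).re) * (T g x).re ≤
      ‖c‖ * (T F x).re - (star c * T f x).re} := by
    apply isClosed_le <;> fun_prop
  exact (TopologicalSpace.denseRange_denseSeq ℂ).induction_on c hcl hx

/-! ### Order and norm in `L^p` -/

/-- The modulus of `f`, cut off outside the measurable set `s`. -/
noncomputable def absOn (f : Lp ℂ p μ) (s : Set Ω) (hs : MeasurableSet s) : Lp ℂ p μ :=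
  ((Lp.memLp f).norm.ofReal (K := ℂ) |>.indicator hs).toLp _

theorem coeFn_absOn (f : Lp ℂ p μ) (s : Set Ω) (hs : MeasurableSet s) :
    absOn f s hs =ᵐ[μ] s.indicator fun x => ((‖f x‖ : ℝ) : ℂ) :=
  MemLp.coeFn_toLp _

theorem absOn_nonneg (f : Lp ℂ p μ) (s : Set Ω) (hs : MeasurableSet s) : 0 ≤ absOn f s hs := by
  rw [← Lp.coeFn_nonneg]
  filter_upwards [coeFn_absOn f s hs] with x hx
  rw [hx]
  exact Set.indicator_nonneg (fun x _ => Complex.zero_le_real.2 (norm_nonneg (f x))) x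

theorem absOn_mono (f : Lp ℂ p μ) {s t : Set Ω} (hs : MeasurableSet s) (ht : MeasurableSet t)
    (h : s ⊆ t) : absOn f s hs ≤ absOn f t ht := by
  rw [← Lp.coeFn_le]
  filter_upwards [coeFn_absOn f s hs, coeFn_absOn f t ht] with x hx hx'
  rw [hx, hx']
  exact Set.indicator_le_indicator_of_subset h
    (fun x => Complex.zero_le_real.2 (norm_nonneg (f x))) x

theorem norm_mono [Fact (1 ≤ p)] {f g : Lp ℂ p μ} (hf : 0 ≤ f) (h : f ≤ g) : ‖f‖ ≤ ‖g‖ := by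
  rw [← Lp.coeFn_nonneg] at hf
  rw [← Lp.coeFn_le] at h
  apply Lp.norm_le_norm_of_ae_le
  filter_upwards [hf, h] with x h1 h2
  exact CStarAlgebra.norm_le_norm_of_nonneg_of_le h1 h2

/-- The `p`-th power of the norm is superadditive on the positive cone of `L^p`. -/
theorem norm_rpow_add_le [Fact (1 ≤ p)] (hp : p ≠ ∞) {f g : Lp ℂ p μ} (hf : 0 ≤ f) (hg : 0 ≤ g) :
    ‖f‖ ^ p.toReal + ‖g‖ ^ p.toReal ≤ ‖f + g‖ ^ p.toReal := by
  have hp0 : p ≠ 0 := (zero_lt_one.trans_le (Fact.out : 1 ≤ p)).ne'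
  have hp1 : 1 ≤ p.toReal := by
    rw [← ENNReal.toReal_one]; exact ENNReal.toReal_mono hp Fact.out
  have hpos : 0 < p.toReal := by linarith
  rw [← Lp.coeFn_nonneg] at hf hg
  have key (f : Lp ℂ p μ) : ENNReal.ofReal (‖f‖ ^ p.toReal) = ∫⁻ x, ‖f x‖ₑ ^ p.toReal ∂μ := by
    rw [← ENNReal.ofReal_rpow_of_nonneg (norm_nonneg _) hpos.le, ofReal_norm, Lp.enorm_def,
      eLpNorm_eq_lintegral_rpow_enorm_toReal hp0 hp, ← ENNReal.rpow_mul,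
      one_div_mul_cancel hpos.ne', ENNReal.rpow_one]
  rw [← ENNReal.ofReal_le_ofReal_iff (by positivity),
    ENNReal.ofReal_add (by positivity) (by positivity), key, key, key,
    ← lintegral_add_left' ((Lp.aestronglyMeasurable f).enorm.pow_const _)]
  apply lintegral_mono_ae
  filter_upwards [hf, hg, Lp.coeFn_add f g] with x h1 h2 h3
  have e : ‖(f + g : Lp ℂ p μ) x‖ₑ = ‖f x‖ₑ + ‖g x‖ₑ := by
    rw [h3, Pi.add_apply, ← ofReal_norm, ← ofReal_norm, ← ofReal_norm,
      ← ENNReal.ofReal_add (norm_nonneg _) (norm_nonneg _)]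
    congr 1
    rw [Pi.zero_apply] at h1 h2
    have n1 := Complex.norm_of_nonneg' h1
    have n2 := Complex.norm_of_nonneg' h2
    have n3 := Complex.norm_of_nonneg' (add_nonneg h1 h2)
    exact_mod_cast n3.trans (congrArg₂ (· + ·) n1 n2).symm
  rw [e]
  exact ENNReal.add_rpow_le_rpow_add _ _ hp1

/-- Norm bounded increasing sequences in the positive cone of `L^p` converge. -/
theorem exists_tendsto_of_monotone [Fact (1 ≤ p)] (hp : p ≠ ∞) {u : ℕ → Lp ℂ p μ}
    (h0 : ∀ n, 0 ≤ u n) (hu : Monotone u) {C : ℝ} (hC : ∀ n, ‖u n‖ ≤ C) :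
    ∃ v, Tendsto u atTop (𝓝 v) := by
  have hp1 : 1 ≤ p.toReal := by
    rw [← ENNReal.toReal_one]; exact ENNReal.toReal_mono hp Fact.out
  have hpos : 0 < p.toReal := by linarith
  set a : ℕ → ℝ := fun n => ‖u n‖ ^ p.toReal with ha
  have hmono : Monotone a := fun m n h =>
    Real.rpow_le_rpow (norm_nonneg _) (norm_mono (h0 m) (hu h)) hpos.le
  have hbdd : BddAbove (Set.range a) := by
    refine ⟨C ^ p.toReal, ?_⟩
    rintro _ ⟨n, rfl⟩
    exact Real.rpow_le_rpow (norm_nonneg _) (hC n) hpos.le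
  have hcau : CauchySeq a := (tendsto_atTop_ciSup hmono hbdd).cauchySeq
  refine cauchySeq_tendsto_of_complete (Metric.cauchySeq_iff'.2 fun ε hε => ?_)
  obtain ⟨N, hN⟩ := Metric.cauchySeq_iff'.1 hcau (ε ^ p.toReal) (by positivity)
  refine ⟨N, fun n hn => ?_⟩
  -- Superadditivity bounds `‖u n - u N‖ ^ p` by the increment of the convergent real sequence `a`.
  have h1 := norm_rpow_add_le hp (sub_nonneg.2 (hu hn)) (h0 N)
  rw [sub_add_cancel] at h1
  have h2 := hN n hn
  rw [Real.dist_eq, abs_of_nonneg (sub_nonneg.2 (hmono hn))] at h2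
  rw [dist_eq_norm]
  exact (Real.rpow_lt_rpow_iff (norm_nonneg _) hε.le hpos).1 (by simp only [ha] at h2; linarith)

/-- If a nonnegative `u` is supported where the nonnegative `w` is, then `u` is the limit of
functions dominated by multiples of `w`. -/
theorem exists_absOn_near [Fact (1 ≤ p)] (hp : p ≠ ∞) {u w : Lp ℂ p μ} (hu : 0 ≤ u) (hw : 0 ≤ w)
    (h : ∀ᵐ x ∂μ, w x = 0 → u x = 0) {ε : ℝ} (hε : 0 < ε) :
    ∃ (k : ℕ) (v : Lp ℂ p μ), 0 ≤ v ∧ v ≤ (k : ℂ) • w ∧ ‖u - v‖ < ε := by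
  have hs (k : ℕ) : MeasurableSet {x | ‖u x‖ ≤ k * ‖w x‖} :=
    measurableSet_le (Lp.stronglyMeasurable u).measurable.norm
      ((Lp.stronglyMeasurable w).measurable.norm.const_mul _)
  set y : ℕ → Lp ℂ p μ := fun k => absOn u _ (hs k) with hy
  have hu' := (Lp.coeFn_nonneg u).2 hu
  have hw' := (Lp.coeFn_nonneg w).2 hw
  have hy0 (k) : 0 ≤ y k := absOn_nonneg _ _ _
  have hyu (k) : y k ≤ u := by
    rw [← Lp.coeFn_le]
    filter_upwards [coeFn_absOn u _ (hs k), hu'] with x h1 h2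
    rw [hy, h1]
    by_cases hx : x ∈ {x | ‖u x‖ ≤ k * ‖w x‖}
    · rw [Set.indicator_of_mem hx, Complex.norm_of_nonneg' h2]
    · rw [Set.indicator_of_notMem hx]
      exact h2
  have hmono : Monotone y := fun k l hkl => by
    apply absOn_mono
    intro x (hx : ‖u x‖ ≤ k * ‖w x‖)
    exact hx.trans (mul_le_mul_of_nonneg_right (by exact_mod_cast hkl) (norm_nonneg _))
  obtain ⟨v, hv⟩ := exists_tendsto_of_monotone hp hy0 hmono fun k => norm_mono (hy0 k) (hyu k)
  -- At almost every point the truncations eventually equal `u`: where `w` vanishes so does `u`,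
  -- elsewhere take `k ≥ ‖u x‖ / ‖w x‖`.
  have hvu : v = u := by
    refine le_antisymm (le_of_tendsto' hv hyu) ?_
    have hyv (k) : y k ≤ v := hmono.ge_of_tendsto hv k
    rw [← Lp.coeFn_le]
    filter_upwards [ae_all_iff.2 fun k => (Lp.coeFn_le _ _).2 (hyv k),
      ae_all_iff.2 fun k => coeFn_absOn u _ (hs k), hu', h] with x h1 h2 h3 h4
    obtain ⟨k, hk⟩ : ∃ k : ℕ, ‖u x‖ ≤ k * ‖w x‖ := by
      by_cases hwx : w x = 0
      · exact ⟨0, by simp [h4 hwx]⟩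
      · obtain ⟨k, hk⟩ := exists_nat_ge (‖u x‖ / ‖w x‖)
        exact ⟨k, (div_le_iff₀ (norm_pos_iff.2 hwx)).1 hk⟩
    have h5 := h1 k
    rw [hy, h2 k, Set.indicator_of_mem (show x ∈ {x | ‖u x‖ ≤ k * ‖w x‖} from hk),
      Complex.norm_of_nonneg' h3] at h5
    exact h5
  rw [hvu] at hv
  obtain ⟨k, hk⟩ := ((tendsto_iff_norm_sub_tendsto_zero.1 hv).eventually (gt_mem_nhds hε)).exists
  refine ⟨k, y k, hy0 k, ?_, by rwa [norm_sub_rev]⟩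
  rw [← Lp.coeFn_le]
  filter_upwards [coeFn_absOn u _ (hs k), hw', Lp.coeFn_smul (k : ℂ) w] with x h1 h2 h3
  rw [hy, h1, h3, Pi.smul_apply, smul_eq_mul, ← Complex.norm_of_nonneg' h2]
  by_cases hx : x ∈ {x | ‖u x‖ ≤ k * ‖w x‖}
  · rw [Set.indicator_of_mem hx]
    exact_mod_cast hx
  · rw [Set.indicator_of_notMem hx]
    exact_mod_cast mul_nonneg k.cast_nonneg (norm_nonneg (w x))

/-! ### Vanishing orbits -/

/-- The orbit of `u` under the powers of `T` tends to zero. -/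
def OrbitVanishes [Fact (1 ≤ p)] (T : Lp ℂ p μ →ₗ[ℂ] Lp ℂ p μ) (u : Lp ℂ p μ) : Prop :=
  Tendsto (fun m => (T ^ m) u) atTop (𝓝 0)

section Orbit

variable [Fact (1 ≤ p)] {T : Lp ℂ p μ →ₗ[ℂ] Lp ℂ p μ}

theorem OrbitVanishes.add {u v : Lp ℂ p μ} (hu : OrbitVanishes T u) (hv : OrbitVanishes T v) :
    OrbitVanishes T (u + v) := by
  simpa [OrbitVanishes] using Tendsto.add hu hv

theorem OrbitVanishes.of_pow {u : Lp ℂ p μ} {n : ℕ} (hu : OrbitVanishes T ((T ^ n) u)) :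
    OrbitVanishes T u := by
  refine (tendsto_add_atTop_iff_nat n).1 ?_
  simpa [OrbitVanishes, pow_add] using hu

/-- Nonnegative functions supported where some nonnegative function with vanishing orbit is
have vanishing orbit. -/
theorem OrbitVanishes.of_support (hp : p ≠ ∞) (hpos : IsPositiveOperator T)
    (hpow : IsPowerBounded T) {u w : Lp ℂ p μ} (hu : 0 ≤ u) (hw : 0 ≤ w)
    (h : ∀ᵐ x ∂μ, w x = 0 → u x = 0) (hT : OrbitVanishes T w) : OrbitVanishes T u := by
  obtain ⟨C, hC⟩ := hpow
  rw [OrbitVanishes, Metric.tendsto_atTop]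
  intro ε hε
  obtain ⟨k, v, hv0, hvw, hk⟩ := exists_absOn_near hp hu hw h
    (show 0 < ε / (2 * (|C| + 1)) by positivity)
  have hT' : Tendsto (fun m => (k : ℂ) • (T ^ m) w) atTop (𝓝 0) := by
    simpa using hT.const_smul (k : ℂ)
  obtain ⟨N, hN⟩ := Metric.tendsto_atTop.1 hT' (ε / 2) (by positivity)
  refine ⟨N, fun m hm => ?_⟩
  have h1 := hN m hm
  rw [dist_zero_right] at h1 ⊢
  have h2 : ‖(T ^ m) v‖ ≤ ‖(k : ℂ) • (T ^ m) w‖ := by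
    rw [← map_smul]
    exact norm_mono ((hpos.pow m).map_nonneg hv0) ((hpos.pow m).mono hvw)
  have h3 : ‖(T ^ m) (u - v)‖ ≤ ε / 2 := by
    calc _ ≤ C * ‖u - v‖ := hC _ _
      _ ≤ (|C| + 1) * (ε / (2 * (|C| + 1))) :=
        mul_le_mul (by linarith [le_abs_self C]) hk.le (norm_nonneg _) (by positivity)
      _ = ε / 2 := by field_simp
  have h4 : (T ^ m) u = (T ^ m) (u - v) + (T ^ m) v := by rw [← map_add, sub_add_cancel]
  rw [h4]
  exact (norm_add_le _ _).trans_lt (by linarith)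

theorem OrbitVanishes.of_le (hpos : IsPositiveOperator T) {u w : Lp ℂ p μ} (hu : 0 ≤ u)
    (h : u ≤ w) (hT : OrbitVanishes T w) : OrbitVanishes T u :=
  squeeze_zero_norm (fun m => norm_mono ((hpos.pow m).map_nonneg hu) ((hpos.pow m).mono h))
    (by simpa using hT.norm)

end Orbit

/-! ### Phases of eigenvectors -/

/-- The points at which the phase of `f` is within distance `r` of `a`. -/
def phaseNear (f : Lp ℂ p μ) (a : ℂ) (r : ℝ) : Set Ω :=
  {x | ‖f x - a * ‖f x‖‖ ≤ r * ‖f x‖}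

theorem measurableSet_phaseNear (f : Lp ℂ p μ) (a : ℂ) (r : ℝ) :
    MeasurableSet (phaseNear f a r) := by
  have hf := (Lp.stronglyMeasurable f).measurable
  exact measurableSet_le
    (hf.sub ((Complex.measurable_ofReal.comp hf.norm).const_mul a)).norm (hf.norm.const_mul r)

/-- The modulus of an eigenvector for a unimodular eigenvalue of a positive operator is
subinvariant. -/
theorem IsPositiveOperator.abs_le {S : Lp ℂ p μ →ₗ[ℂ] Lp ℂ p μ} (hS : IsPositiveOperator S)
    {f : Lp ℂ p μ} {z : ℂ} (hz : ‖z‖ = 1) (hf : S f = z • f) :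
    absOn f Set.univ .univ ≤ S (absOn f Set.univ .univ) := by
  have h := hS.ae_forall_le (f := f) (F := absOn f Set.univ .univ) (g := 0) 0 0 (fun c => by
    filter_upwards [coeFn_absOn f Set.univ .univ, Lp.coeFn_zero ℂ p μ] with x h1 h2
    rw [h1, h2]
    have : (star c * f x).re ≤ ‖c‖ * ‖f x‖ := by
      simpa using Complex.re_le_norm (star c * f x)
    simpa using this)
  have hF := (Lp.coeFn_nonneg _).2 (hS.map_nonneg (absOn_nonneg f Set.univ .univ))
  rw [← Lp.coeFn_le]
  filter_upwards [h, hF, coeFn_absOn f Set.univ .univ, Lp.coeFn_smul z f] with x h1 h2 h3 h4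
  -- Testing with `c = S f x` turns the real-part bounds into a bound on the modulus.
  have h5 := h1 (z * f x)
  rw [hf, h4, Pi.smul_apply, smul_eq_mul] at h5
  have e : (star (z * f x) * (z * f x)).re = ‖f x‖ ^ 2 := by
    have : star (z * f x) * (z * f x) = ((‖z * f x‖ ^ 2 : ℝ) : ℂ) := by
      rw [Complex.star_def, Complex.conj_mul']; norm_cast
    rw [this, Complex.ofReal_re, norm_mul, hz, one_mul]
  rw [e, norm_mul, hz] at h5
  obtain ⟨h6, h7⟩ := Complex.le_def.1 h2
  rw [h3, Set.indicator_univ, Complex.le_def]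
  refine ⟨?_, by simpa using h7⟩
  rw [Complex.ofReal_re]
  rcases (norm_nonneg (f x)).eq_or_lt with h8 | h8
  · rw [← h8]; exact h6
  · refine le_of_mul_le_mul_left ?_ h8
    simp only [mul_zero, Complex.zero_re, sub_zero, zero_mul] at h5
    linarith

/-- Where `S |f| = |f|`, a positive operator `S` with `S f = z f`, `‖z‖ = 1`, moves the part of
`|f|` with phase near `a` into the set where the phase of `z f` is near `a`. -/
theorem IsPositiveOperator.phase_transport {S : Lp ℂ p μ →ₗ[ℂ] Lp ℂ p μ}
    (hS : IsPositiveOperator S) {f : Lp ℂ p μ} {z a : ℂ} (hz : ‖z‖ = 1) (ha : ‖a‖ = 1)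
    (hf : S f = z • f) (r : ℝ) :
    ∀ᵐ x ∂μ, S (absOn f _ (measurableSet_phaseNear f a r)) x ≠ 0 →
      (S (absOn f Set.univ .univ) - absOn f Set.univ .univ : Lp ℂ p μ) x = 0 →
      f x ≠ 0 ∧ ‖z * f x - a * ‖f x‖‖ ^ 2 ≤ 2 * r * ‖f x‖ ^ 2 := by
  set g := absOn f _ (measurableSet_phaseNear f a r) with hg
  set F := absOn f Set.univ .univ with hF
  have h := hS.ae_forall_le (f := f) (F := F) (g := g) a (1 - r) (fun c => by
    filter_upwards [coeFn_absOn f Set.univ .univ,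
      coeFn_absOn f _ (measurableSet_phaseNear f a r)] with x h1 h2
    rw [hg, hF, h1, h2, Set.indicator_univ]
    by_cases hx : x ∈ phaseNear f a r
    · rw [Set.indicator_of_mem hx]
      have hle : (star c * (f x - a * ‖f x‖)).re ≤ ‖c‖ * (r * ‖f x‖) := by
        refine (Complex.re_le_norm _).trans ?_
        rw [norm_mul, norm_star]
        exact mul_le_mul_of_nonneg_left hx (norm_nonneg c)
      rw [mul_sub, ← mul_assoc, Complex.sub_re, Complex.re_mul_ofReal] at hle
      rw [Complex.ofReal_re]
      linarith
    · rw [Set.indicator_of_notMem hx]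
      have : (star c * f x).re ≤ ‖c‖ * ‖f x‖ := by
        simpa using Complex.re_le_norm (star c * f x)
      simpa using this)
  have hg0 := (Lp.coeFn_nonneg _).2 (hS.map_nonneg (absOn_nonneg f _
    (measurableSet_phaseNear f a r)))
  have hgF := (Lp.coeFn_le _ _).2 (hS.mono (absOn_mono f (measurableSet_phaseNear f a r) .univ
    (Set.subset_univ _)))
  filter_upwards [h, hg0, hgF, coeFn_absOn f Set.univ .univ, Lp.coeFn_smul z f,
    Lp.coeFn_sub (S F) F] with x h1 h2 h3 h4 h5 h6 hne heq
  rw [h6, Pi.sub_apply, sub_eq_zero, hF, h4, Set.indicator_univ] at heq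
  rw [heq] at h3
  have hfx : f x ≠ 0 := by
    intro h0
    rw [h0] at h3
    exact hne (le_antisymm (by simpa using h3) h2)
  refine ⟨hfx, ?_⟩
  have hpos : 0 < (S g x).re := by
    obtain ⟨h7, h8⟩ := Complex.le_def.1 h2
    refine lt_of_le_of_ne h7 fun h9 => hne (Complex.ext h9.symm h8.symm)
  have hN : 0 < ‖f x‖ := norm_pos_iff.2 hfx
  have h7 := h1 (z * f x)
  rw [hf, h5, heq, Pi.smul_apply, smul_eq_mul] at h7
  have e : (star (z * f x) * (z * f x)).re = ‖f x‖ ^ 2 := by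
    have : star (z * f x) * (z * f x) = ((‖z * f x‖ ^ 2 : ℝ) : ℂ) := by
      rw [Complex.star_def, Complex.conj_mul']; norm_cast
    rw [this, Complex.ofReal_re, norm_mul, hz, one_mul]
  rw [e, norm_mul, hz, one_mul, Complex.ofReal_re, ← sq, sub_self] at h7
  -- Since `S F = F` at `x`, the choice `c = z * f x` makes the right side of `h7` zero, while `S g
  -- x` is positive.
  have h8 : ‖f x‖ * (1 - r) - (star (z * f x) * a).re ≤ 0 := by
    by_contra! hlt
    exact absurd h7 (not_le.2 (mul_pos hlt hpos))
  have h9 : ‖z * f x - a * ‖f x‖‖ ^ 2 =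
      2 * ‖f x‖ ^ 2 - 2 * ‖f x‖ * (star (z * f x) * a).re := by
    have e1 : ‖z * f x‖ ^ 2 = ‖f x‖ ^ 2 := by rw [norm_mul, hz, one_mul]
    have e2 : ‖a * (‖f x‖ : ℂ)‖ ^ 2 = ‖f x‖ ^ 2 := by simp [ha]
    have e3 : (star (z * f x) * (a * ‖f x‖)).re = ‖f x‖ * (star (z * f x) * a).re := by
      rw [← mul_assoc, Complex.re_mul_ofReal, mul_comm]
    have := @norm_sub_sq ℂ ℂ _ _ _ (z * f x) (a * ‖f x‖)
    rw [e1, e2, RCLike.inner_apply'] at this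
    change _ = ‖f x‖ ^ 2 - 2 * (star (z * f x) * (a * ‖f x‖)).re + ‖f x‖ ^ 2 at this
    rw [this, e3]
    ring
  rw [h9]
  nlinarith

/-! ### Eigenvectors for unimodular eigenvalues -/

variable [Fact (1 ≤ p)] {T : Lp ℂ p μ →ₗ[ℂ] Lp ℂ p μ}

/-- The modulus of an eigenvector for a unimodular eigenvalue is invariant up to functions with
vanishing orbit. -/
theorem orbitVanishes_pow_sub (hp : p ≠ ∞) (hpos : IsPositiveOperator T)
    (hpow : IsPowerBounded T) {F : Lp ℂ p μ} (hF : 0 ≤ F) (hTF : F ≤ T F) (n : ℕ) :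
    OrbitVanishes T ((T ^ n) F - F) := by
  obtain ⟨C, hC⟩ := hpow
  have hmono : Monotone fun m => (T ^ m) F := monotone_nat_of_le_succ fun m => by
    rw [pow_succ]
    exact (hpos.pow m).mono hTF
  obtain ⟨v, hv⟩ := exists_tendsto_of_monotone hp
    (fun m => (hpos.pow m).map_nonneg hF) hmono (fun m => hC m F)
  have := ((tendsto_add_atTop_iff_nat n).2 hv).sub hv
  simpa [OrbitVanishes, pow_add] using this

theorem orbitVanishes_absOn_phaseNear (hp : p ≠ ∞) (hpos : IsPositiveOperator T)
    (hpow : IsPowerBounded T)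
    (hsupp : ∀ f : Lp ℂ p μ, Nonneg f →
      ∃ n : ℕ, 1 ≤ n ∧ SupportContains ((T ^ n) f) ((T ^ (n - 1)) f))
    {f : Lp ℂ p μ} {z a : ℂ} (hz : ‖z‖ = 1) (ha : ‖a‖ = 1) (hf : T f = z • f) {r : ℝ}
    (hr : 8 * r < ‖z - 1‖ ^ 2) :
    OrbitVanishes T (absOn f _ (measurableSet_phaseNear f a r)) := by
  set g := absOn f _ (measurableSet_phaseNear f a r) with hg
  set F := absOn f Set.univ .univ with hF
  have hF0 : 0 ≤ F := absOn_nonneg _ _ _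
  have hg0 : 0 ≤ g := absOn_nonneg _ _ _
  have hpowf (n : ℕ) : (T ^ n) f = z ^ n • f := by
    induction n with
    | zero => simp
    | succ n ih => rw [pow_succ, Module.End.mul_apply, hf, map_smul, ih, smul_smul, pow_succ']
  have hzn (n : ℕ) : ‖z ^ n‖ = 1 := by simp [hz]
  have hv0 (n : ℕ) : 0 ≤ (T ^ n) F - F := sub_nonneg.2 ((hpos.pow n).abs_le (hzn n) (hpowf n))
  have hvJ (n : ℕ) := orbitVanishes_pow_sub hp hpos hpow hF0 (hpos.abs_le hz hf) n
  obtain ⟨n, hn, hsub⟩ := hsupp g (nonneg_iff.2 hg0)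
  obtain ⟨k, rfl⟩ : ∃ k, n = k + 1 := ⟨n - 1, by omega⟩
  rw [Nat.add_sub_cancel] at hsub
  refine OrbitVanishes.of_pow (n := k) (OrbitVanishes.of_support hp hpos hpow
    ((hpos.pow k).map_nonneg hg0) (add_nonneg (hv0 k) (hv0 (k + 1))) ?_
    ((hvJ k).add (hvJ (k + 1))))
  filter_upwards [hsub, (hpos.pow k).phase_transport (hzn k) ha (hpowf k) r,
    (hpos.pow (k + 1)).phase_transport (hzn (k + 1)) ha (hpowf (k + 1)) r,
    (Lp.coeFn_nonneg _).2 (hv0 k), (Lp.coeFn_nonneg _).2 (hv0 (k + 1)),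
    Lp.coeFn_add ((T ^ k) F - F) ((T ^ (k + 1)) F - F)] with x h1 h2 h3 h4 h5 h6 h7
  by_contra hne
  rw [h6, Pi.add_apply, add_eq_zero_iff_of_nonneg h4 h5] at h7
  obtain ⟨hfx, h8⟩ := h2 hne h7.1
  obtain ⟨-, h9⟩ := h3 (h1 hne) h7.2
  have hN : 0 < ‖f x‖ := norm_pos_iff.2 hfx
  -- Multiplying by `z` turns phase `a` at time `k` into `z * a` at time `k + 1`, which must also be
  -- near `a`.
  have e : a * ‖f x‖ * (z - 1) = (z ^ (k + 1) * f x - a * ‖f x‖) -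
      z * (z ^ k * f x - a * ‖f x‖) := by ring
  have h10 : ‖f x‖ * ‖z - 1‖ ≤
      ‖z ^ (k + 1) * f x - a * ‖f x‖‖ + ‖z ^ k * f x - a * ‖f x‖‖ := by
    have := norm_sub_le (z ^ (k + 1) * f x - a * ‖f x‖) (z * (z ^ k * f x - a * ‖f x‖))
    rw [← e, norm_mul z, hz, one_mul, norm_mul, norm_mul, ha, one_mul, Complex.norm_real,
      norm_norm] at this
    exact this
  -- The 8 is `2 * (2 + 2)`: `add_sq_le` applied to two squares, each at most `2 * r * ‖f x‖ ^ 2`.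
  have h11 : (‖f x‖ * ‖z - 1‖) ^ 2 ≤ 8 * r * ‖f x‖ ^ 2 := by
    refine (pow_le_pow_left₀ (by positivity) h10 2).trans ((add_sq_le).trans ?_)
    linarith
  have h12 : 0 < ‖f x‖ ^ 2 := by positivity
  rw [mul_pow] at h11
  nlinarith

theorem eq_zero_of_eigenvector (hp : p ≠ ∞) (hpos : IsPositiveOperator T)
    (hpow : IsPowerBounded T)
    (hsupp : ∀ f : Lp ℂ p μ, Nonneg f →
      ∃ n : ℕ, 1 ≤ n ∧ SupportContains ((T ^ n) f) ((T ^ (n - 1)) f))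
    {f : Lp ℂ p μ} {z : ℂ} (hz : ‖z‖ = 1) (hz1 : z ≠ 1) (hf : T f = z • f) : f = 0 := by
  have hd : 0 < ‖z - 1‖ := norm_pos_iff.2 (sub_ne_zero.2 hz1)
  -- Any positive `r` with `8 * r < ‖z - 1‖ ^ 2` would do.
  set r := ‖z - 1‖ ^ 2 / 16 with hr
  have hr0 : 0 < r := by positivity
  obtain ⟨t, hts, htf, hcov⟩ :=
    finite_cover_balls_of_compact (isCompact_sphere (0 : ℂ) 1) hr0
  lift t to Finset ℂ using htf
  set F := absOn f Set.univ .univ with hF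
  set g : ℂ → Lp ℂ p μ := fun a => absOn f _ (measurableSet_phaseNear f a r) with hg
  have hF0 : 0 ≤ F := absOn_nonneg _ _ _
  have hg0 (a) : 0 ≤ g a := absOn_nonneg _ _ _
  have hgJ : OrbitVanishes T (∑ a ∈ t, g a) := by
    have : Tendsto (fun m => ∑ a ∈ t, (T ^ m) (g a)) atTop (𝓝 (∑ a ∈ t, 0)) :=
      tendsto_finsetSum t fun a ha => orbitVanishes_absOn_phaseNear hp hpos hpow hsupp hz
        (by simpa using hts ha) hf (by rw [hr]; linarith [pow_pos hd 2])
    simpa [OrbitVanishes] using this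
  have hle : F ≤ ∑ a ∈ t, g a := by
    have h1 : ∀ᵐ x ∂μ, ∀ a ∈ (t : Set ℂ), g a x ≤ (∑ a ∈ t, g a) x :=
      (ae_ball_iff t.countable_toSet).2 fun a ha =>
        (Lp.coeFn_le _ _).2 (Finset.single_le_sum (fun b _ => hg0 b) ha)
    have h2 : ∀ᵐ x ∂μ, ∀ a ∈ (t : Set ℂ), g a x =
        (phaseNear f a r).indicator (fun x => ((‖f x‖ : ℝ) : ℂ)) x :=
      (ae_ball_iff t.countable_toSet).2 fun a _ => coeFn_absOn f _ _
    have h3 := (Lp.coeFn_nonneg _).2 (Finset.sum_nonneg fun a (_ : a ∈ t) => hg0 a)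
    rw [← Lp.coeFn_le]
    filter_upwards [h1, h2, h3, coeFn_absOn f Set.univ .univ] with x h1 h2 h3 h4
    rw [hF, h4, Set.indicator_univ]
    by_cases hfx : f x = 0
    · simpa [hfx] using h3
    have hN : 0 < ‖f x‖ := norm_pos_iff.2 hfx
    have hs : f x / ‖f x‖ ∈ Metric.sphere (0 : ℂ) 1 := by simp [hN.ne']
    obtain ⟨a, ha, hax⟩ := Set.mem_iUnion₂.1 (hcov hs)
    have hmem : x ∈ phaseNear f a r := by
      rw [Metric.mem_ball, dist_eq_norm] at hax
      have e : f x - a * ‖f x‖ = (f x / ‖f x‖ - a) * ‖f x‖ := by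
        have : (‖f x‖ : ℂ) ≠ 0 := by exact_mod_cast hN.ne'
        field_simp
      change ‖f x - a * ‖f x‖‖ ≤ r * ‖f x‖
      rw [e, norm_mul, Complex.norm_real, norm_norm]
      exact mul_le_mul_of_nonneg_right hax.le hN.le
    have h5 := h1 a ha
    rwa [h2 a ha, Set.indicator_of_mem hmem] at h5
  have hFJ : OrbitVanishes T F := hgJ.of_le hpos hF0 hle
  have hmono : Monotone fun m => (T ^ m) F := monotone_nat_of_le_succ fun m => by
    rw [pow_succ]
    exact (hpos.pow m).mono (hpos.abs_le hz hf)
  have hFz : F = 0 := le_antisymm (by simpa using hmono.ge_of_tendsto hFJ 0) hF0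
  apply Lp.ext
  filter_upwards [coeFn_absOn f Set.univ .univ, Lp.coeFn_zero ℂ p μ] with x h1 h2
  rw [← hF, hFz, h2, Set.indicator_univ] at h1
  rw [h2]
  simpa using h1.symm

end Aperiodicity

theorem theorem1p1 {Ω : Type*} [MeasurableSpace Ω] (μ : Measure Ω) [SigmaFinite μ]
    (p : ℝ≥0∞) [Fact (1 ≤ p)] (hp : p ≠ ∞)
    (T : Lp ℂ p μ →ₗ[ℂ] Lp ℂ p μ)
    (hpos : Aperiodicity.IsPositiveOperator T)
    (hpow : Aperiodicity.IsPowerBounded T)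
    (hsupp : ∀ f : Lp ℂ p μ, Aperiodicity.Nonneg f →
      ∃ n : ℕ, 1 ≤ n ∧ Aperiodicity.SupportContains ((T ^ n) f) ((T ^ (n - 1)) f)) :
    Aperiodicity.pointSpectrum T ∩ {z : ℂ | ‖z‖ = 1} ⊆ {1} := by
  rintro z ⟨hev, hz⟩
  by_contra hz1
  obtain ⟨f, hf⟩ := Module.End.HasEigenvalue.exists_hasEigenvector hev
  exact hf.2 (Aperiodicity.eq_zero_of_eigenvector hp hpos hpow hsupp hz hz1 hf.apply_eq_smul)
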